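/- Let $d \in \mathbb{N} \cup \{\infty\}$, let $\mathbb{C}^d$ carry the Euclidean inner product $\langle z,w\rangle$ (linear in $z$), where $\mathbb{C}^\infty := \ell^2$, and let $\mathbb{B}_d$ be the open unit ball of $\mathbb{C}^d$. Let $\mathcal{H}$ be a unitarily invariant space on $\mathbb{B}_d$, that is, a Hilbert space of functions $\mathbb{B}_d \to \mathbb{C}$ with bounded point evaluations whose reproducing kernel is of the form $$K(z,w) = \sum_{n=0}^\infty a_n \langle z,w\rangle^n \quad (z,w\in\mathbb{B}_d), \qquad a_0 = 1,\ a_1 > 0,\ a_n \ge 0 \text{ for all } n \ge 2 .$$ Suppose that for no $\gamma \in (0,\infty)$ is $\mathcal{H}$ equal to $\mathcal{H}_\gamma$, the reproducing kernel Hilbert space on $\mathbb{B}_d$ with kernel $(1-\langle z,w\rangle)^{-\gamma}$ (principal branch). Let $\phi$ be a biholomorphic automorphism of $\mathbb{B}_d$, that is, a holomorphic bijection $\mathbb{B}_d \to \mathbb{B}_d$ with holomorphic inverse, and let $\delta : \mathbb{B}_d \to \mathbb{C}$ be any function. If the weighted composition operator $$W_{\delta,\phi} : \mathcal{H} \to \mathcal{H},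 \qquad f \mapsto \delta\cdot(f\circ\phi),$$ is well defined, bounded and co-isometric (i.e. $W_{\delta,\phi}W_{\delta,\phi}^* = I$), then $\phi$ is unitary, i.e. the restriction to $\mathbb{B}_d$ of a unitary operator on $\mathbb{C}^d$. -/

import Mathlib

/-- The Hilbert space `ℂ^d` for `d ∈ ℕ ∪ {∞}`: the space of square summable families
indexed by `{n : ℕ | n < d}`. For finite `d` this is `ℂ^d` with the Euclidean norm, for `d = ∞`
it is `ℓ²`. -/
abbrev HilbertC (d : ℕ∞) : Type :=
  lp (fun _ : {n : ℕ // (n : ℕ∞) < d} => ℂ) 2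

/-- The open unit ball `𝔹_d` of `ℂ^d`, as a type. -/
abbrev UnitBallC (d : ℕ∞) : Type :=
  Metric.ball (0 : HilbertC d) 1

/-- The scalar product `⟨z, w⟩`, linear in the first and conjugate linear in the second variable
(Mathlib's `inner` is conjugate linear in its first argument). -/
noncomputable def pairing {d : ℕ∞} (z w : UnitBallC d) : ℂ :=
  inner ℂ (w : HilbertC d) (z : HilbertC d)

/-- The reproducing kernel `K(x, y) = ⟨K_y, K_x⟩` of a Hilbert space `H` of complex-valued functions
on `X`. In Mathlib the kernel is operator valued; here it takes values in operators on `ℂ`, which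
are identified with complex numbers by evaluation at `1`. -/
noncomputable def scalarKernel {X : Type*} (H : Type*) [NormedAddCommGroup H]
    [InnerProductSpace ℂ H] [CompleteSpace H] [RKHS ℂ H X ℂ] (x y : X) : ℂ :=
  RKHS.kernel H x y 1

/-- A reproducing kernel Hilbert space on `𝔹_d` is unitarily invariant if its kernel is
`K(z, w) = ∑ aₙ ⟨z, w⟩ⁿ` with `aₙ ≥ 0`, `a₀ = 1` and `a₁ > 0`. -/
def IsUnitarilyInvariant (d : ℕ∞) (H : Type*) [NormedAddCommGroup H]
    [InnerProductSpace ℂ H] [CompleteSpace H] [RKHS ℂ H (UnitBallC d) ℂ] : Prop :=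
  ∃ a : ℕ → ℝ, (∀ n, 0 ≤ a n) ∧ a 0 = 1 ∧ 0 < a 1 ∧
    ∀ z w : UnitBallC d, HasSum (fun n => (a n : ℂ) * pairing z w ^ n) (scalarKernel H z w)

/-- `H` is the space `H_γ`, i.e. the reproducing kernel Hilbert space on `𝔹_d` with kernel
`1 / (1 - ⟨z, w⟩) ^ γ` (principal branch; `1 - ⟨z, w⟩` has positive real part). -/
def IsHGamma (d : ℕ∞) (γ : ℝ) (H : Type*) [NormedAddCommGroup H]
    [InnerProductSpace ℂ H] [CompleteSpace H] [RKHS ℂ H (UnitBallC d) ℂ] : Prop :=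
  ∀ z w : UnitBallC d, scalarKernel H z w = 1 / (1 - pairing z w) ^ (γ : ℂ)

/-- A self-map of the ball is holomorphic: it is (the restriction of a map that is) complex Fréchet
differentiable at every point of the open ball. -/
def IsHolomorphicBallMap {d : ℕ∞} (φ : UnitBallC d → UnitBallC d) : Prop :=
  ∃ F : HilbertC d → HilbertC d, DifferentiableOn ℂ F (Metric.ball 0 1) ∧
    ∀ z : UnitBallC d, F z = φ z

/-- `φ ∈ Aut(𝔹_d)`: `φ` is a holomorphic bijection of the ball with holomorphic inverse. -/
def IsBallAutomorphism {d : ℕ∞} (φ : UnitBallC d → UnitBallC d) : Prop :=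
  IsHolomorphicBallMap φ ∧ ∃ ψ : UnitBallC d → UnitBallC d,
    Function.LeftInverse ψ φ ∧ Function.RightInverse ψ φ ∧ IsHolomorphicBallMap ψ

/-- The weighted composition operator `f ↦ δ · (f ∘ φ)` is a well-defined bounded operator `T` on
the reproducing kernel Hilbert space `H`, and it is a co-isometry: `T T* = I`. -/
def IsCoisometricWCO {X : Type*} (H : Type*) [NormedAddCommGroup H]
    [InnerProductSpace ℂ H] [CompleteSpace H] [RKHS ℂ H X ℂ] (δ : X → ℂ) (φ : X → X) : Prop :=
  ∃ T : H →L[ℂ] H, (∀ (f : H) (x : X), T f x = δ x * f (φ x)) ∧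
    T ∘L ContinuousLinearMap.adjoint T = ContinuousLinearMap.id ℂ H

/-- `φ` is (the restriction to the ball of) a unitary operator on `ℂ^d`. -/
def IsUnitaryBallMap {d : ℕ∞} (φ : UnitBallC d → UnitBallC d) : Prop :=
  ∃ U : HilbertC d ≃ₗᵢ[ℂ] HilbertC d, ∀ z : UnitBallC d, (φ z : HilbertC d) = U z

open Metric Set Complex ComplexConjugate

/-! Write `K(z,w) = k(⟨z,w⟩)`. A co-isometric `W` forces `K(x,y) = δ(x) conj(δ(y)) K(φ x, φ y)`. If
`φ p = 0`, then `K(·, φ p) = 1`, and the weight cancels: `K(x,y) K(p,p) = K(x,p) K(p,y) K(φ x, φ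
y)`. If `φ 0 = 0`, Cartan's theorem makes `φ` unitary. Otherwise `p = r e` with `0 < r < 1` and `‖e‖
= 1`, and the equality case of the Schwarz lemma shows that `φ` carries `w e` to `θ(w) C`, where `θ`
is `discInvolution r` and `C` a unit vector. On this single disc the identity reads `k(uv) k(r²) =
k(ur) k(rv) k(θ(u) θ(v))`. Its `v`-derivative at `0` is the equation `(1 - t) k' = a₁ k` near `0`,
so `k = (1 - t)^(-a₁)` and the space is `H_γ` with `γ = a₁`, which is excluded. -/

/-- The involutive automorphism of the unit disc exchanging `0` and the real number `r`. -/
noncomputable def discInvolution (r : ℝ) (z : ℂ) : ℂ := (r - z) / (1 - r * z)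

/-! ### Möbius involutions of the disc -/

section DiscInvolution

variable {r : ℝ} {z : ℂ}

lemma one_sub_real_mul_ne_zero (hr0 : 0 < r) (hr1 : r < 1) (hz : ‖z‖ < 1) :
    (1 : ℂ) - r * z ≠ 0 := by
  intro h
  have h1 : (r : ℂ) * z = 1 := (sub_eq_zero.mp h).symm
  have h2 : r * ‖z‖ = 1 := by
    have := congrArg norm h1
    rwa [norm_mul, norm_one, Complex.norm_real, Real.norm_of_nonneg hr0.le] at this
  nlinarith [norm_nonneg z]

lemma norm_discInvolution_lt_one (hr0 : 0 < r) (hr1 : r < 1) (hz : ‖z‖ < 1) :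
    ‖discInvolution r z‖ < 1 := by
  have hne := one_sub_real_mul_ne_zero hr0 hr1 hz
  rw [discInvolution, norm_div, div_lt_one (norm_pos_iff.mpr hne)]
  refine lt_of_pow_lt_pow_left₀ 2 (norm_nonneg _) ?_
  have hz2 : z.re * z.re + z.im * z.im < 1 := by
    have h := Complex.sq_norm z
    rw [Complex.normSq_apply] at h
    nlinarith [norm_nonneg z]
  rw [Complex.sq_norm, Complex.sq_norm, Complex.normSq_apply, Complex.normSq_apply]
  simp only [sub_re, sub_im, ofReal_re, ofReal_im, one_re, one_im, mul_re, mul_im]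
  -- This is `|1 - rz|² - |r - z|² = (1 - r²)(1 - |z|²) > 0`.
  nlinarith [mul_pos (sub_pos.mpr hz2) (sub_pos.mpr (show r ^ 2 < 1 by nlinarith))]

lemma discInvolution_discInvolution (hr0 : 0 < r) (hr1 : r < 1) (hz : ‖z‖ < 1) :
    discInvolution r (discInvolution r z) = z := by
  have h1 := one_sub_real_mul_ne_zero hr0 hr1 hz
  have h2 := one_sub_real_mul_ne_zero hr0 hr1 (norm_discInvolution_lt_one hr0 hr1 hz)
  rw [discInvolution, div_eq_iff h2]
  unfold discInvolution
  field_simp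
  ring

lemma hasDerivAt_discInvolution (h : (1 : ℂ) - r * z ≠ 0) :
    HasDerivAt (discInvolution r) (((r : ℂ) ^ 2 - 1) / (1 - r * z) ^ 2) z := by
  have h1 : HasDerivAt (fun w : ℂ => (r : ℂ) - w) (-1) z := (hasDerivAt_id z).const_sub _
  have h2 : HasDerivAt (fun w : ℂ => 1 - (r : ℂ) * w) (-(r : ℂ)) z := by
    simpa using ((hasDerivAt_id z).const_mul (r : ℂ)).const_sub 1
  convert! h1.div h2 h using 1
  ring

@[simp] lemma discInvolution_zero : discInvolution r 0 = r := by simp [discInvolution]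

@[simp] lemma discInvolution_self : discInvolution r r = 0 := by simp [discInvolution]

lemma conj_discInvolution : conj (discInvolution r z) = discInvolution r (conj z) := by
  simp [discInvolution]

end DiscInvolution

/-! ### From Möbius covariance to a power of `1 - t` -/

section PowerFunction

/-- A holomorphic solution near the origin of `(1 - t) k' = c k`, `k 0 = 1`, which is defined on
the unit disc, is `(1 - t) ^ (-c)`. -/
lemma eq_one_div_cpow_of_hasDerivAt {k : ℂ → ℂ} {c : ℂ} {r : ℝ} (hr0 : 0 < r) (hr1 : r < 1)
    (hk : DifferentiableOn ℂ k (ball 0 1)) (hk0 : k 0 = 1)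
    (hode : ∀ t : ℂ, ‖t‖ < r → (1 - t) * deriv k t = c * k t) {t : ℂ} (ht : ‖t‖ < 1) :
    k t = 1 / (1 - t) ^ c := by
  have hslit : ∀ s : ℂ, ‖s‖ < 1 → 1 - s ∈ slitPlane := fun s hs => by
    left
    have := (Complex.abs_re_le_norm s).trans_lt hs
    simp only [sub_re, one_re]
    linarith [(abs_lt.mp this).2]
  have hpow : ∀ s : ℂ, ‖s‖ < 1 →
      HasDerivAt (fun s : ℂ => (1 - s) ^ c) (c * (1 - s) ^ (c - 1) * (-1)) s := fun s hs =>
    HasDerivAt.cpow_const ((hasDerivAt_id s).const_sub 1) (hslit s hs)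
  have hkd : ∀ s : ℂ, ‖s‖ < 1 → HasDerivAt k (deriv k s) s := fun s hs =>
    ((hk s (mem_ball_zero_iff.mpr hs)).differentiableAt
      (isOpen_ball.mem_nhds (mem_ball_zero_iff.mpr hs))).hasDerivAt
  have hprod : ∀ s : ℂ, ‖s‖ < 1 → HasDerivAt (fun s => k s * (1 - s) ^ c)
      (deriv k s * (1 - s) ^ c + k s * (c * (1 - s) ^ (c - 1) * (-1))) s := fun s hs =>
    (hkd s hs).mul (hpow s hs)
  have hdiff : DifferentiableOn ℂ (fun s => k s * (1 - s) ^ c) (ball 0 1) := fun s hs =>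
    (hprod s (mem_ball_zero_iff.mp hs)).differentiableAt.differentiableWithinAt
  have hsmall : EqOn (fun s => k s * (1 - s) ^ c) (fun _ => 1) (ball 0 r) := by
    intro s hs
    have hconst := IsOpen.is_const_of_deriv_eq_zero (𝕜 := ℂ) isOpen_ball
      (convex_ball (0 : ℂ) r).isPreconnected (hdiff.mono (ball_subset_ball hr1.le)) (fun s hs => by
        have hsr : ‖s‖ < r := mem_ball_zero_iff.mp hs
        have hs1 := hsr.trans hr1
        have hne : 1 - s ≠ 0 := slitPlane_ne_zero (hslit s hs1)
        rw [(hprod s hs1).deriv, cpow_sub _ _ hne, cpow_one]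
        have h := hode s hsr
        simp only [Pi.zero_apply]
        field_simp
        linear_combination ((1 - s) ^ c) * h) hs (mem_ball_self hr0)
    simpa [hk0] using hconst
  -- The equation is known only for `‖t‖ < r`; the identity theorem carries the constancy of `k (1 -
  -- s)^c` to the whole disc.
  have hall := (hdiff.analyticOnNhd isOpen_ball).eqOn_of_preconnected_of_eventuallyEq
    (analyticOnNhd_const (v := (1 : ℂ))) (convex_ball (0 : ℂ) 1).isPreconnected
    (mem_ball_self one_pos) (hsmall.eventuallyEq_of_mem (ball_mem_nhds _ hr0))
  have h := hall (mem_ball_zero_iff.mpr ht)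
  refine eq_one_div_of_mul_eq_one_left ?_
  simpa using h

/-- A holomorphic function on the disc which is Möbius covariant with respect to a single
involution exchanging `0` and `r ≠ 0` is a power of `1 - t`. -/
lemma eq_one_div_cpow_of_discInvolution_covariant {k : ℂ → ℂ} {c : ℂ} {r : ℝ}
    (hr0 : 0 < r) (hr1 : r < 1) (hk : DifferentiableOn ℂ k (ball 0 1)) (hk0 : k 0 = 1)
    (hk1 : deriv k 0 = c) (hkr : k (r * r) ≠ 0)
    (hcov : ∀ u v : ℂ, ‖u‖ < 1 → ‖v‖ < 1 → k (u * v) * k (r * r) =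
      k (u * r) * k (r * v) * k (discInvolution r u * discInvolution r v))
    {t : ℂ} (ht : ‖t‖ < 1) : k t = 1 / (1 - t) ^ c := by
  have hrC : (r : ℂ) ≠ 0 := by exact_mod_cast hr0.ne'
  have hrn : ‖(r : ℂ)‖ = r := by rw [Complex.norm_real, Real.norm_of_nonneg hr0.le]
  have hkd : ∀ s : ℂ, ‖s‖ < 1 → HasDerivAt k (deriv k s) s := fun s hs =>
    ((hk s (mem_ball_zero_iff.mpr hs)).differentiableAt
      (isOpen_ball.mem_nhds (mem_ball_zero_iff.mpr hs))).hasDerivAt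
  refine eq_one_div_cpow_of_hasDerivAt hr0 hr1 hk hk0 (fun s hs => ?_) ht
  rcases eq_or_ne s 0 with rfl | hs0
  · simp [hk0, hk1]
  -- To get the equation at `s = r x`, take `u = θ(x)`: then `θ(u) = x`, and the last factor at `v =
  -- 0` is `k(x r)`. The bound `‖s‖ < r` is what puts `x` in the disc.
  obtain ⟨x, rfl⟩ : ∃ x : ℂ, s = r * x := ⟨s / r, by field_simp⟩
  have hx0 : x ≠ 0 := right_ne_zero_of_mul hs0
  have hx : ‖x‖ < 1 := by
    rw [norm_mul, hrn] at hs
    nlinarith [norm_nonneg x]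
  set u := discInvolution r x with hu
  have hu1 : ‖u‖ < 1 := norm_discInvolution_lt_one hr0 hr1 hx
  have hux : discInvolution r u = x := discInvolution_discInvolution hr0 hr1 hx
  have hne := one_sub_real_mul_ne_zero hr0 hr1 hx
  have hcov0 : k (r * r) = k (u * r) * k (r * x) := by
    have := hcov u 0 hu1 (by simp)
    simpa [hk0, hux, mul_comm x] using this
  have hkur : k (u * r) ≠ 0 := fun h => hkr (by rw [hcov0, h, zero_mul])
  -- Both sides of the covariance are differentiated in `v` at `0`, where `θ(0) = r` and `θ'(0) = r²
  -- - 1`.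
  have hL : HasDerivAt (fun v : ℂ => k (u * v) * k (r * r)) (c * u * k (r * r)) 0 := by
    have h1 : HasDerivAt (fun v : ℂ => u * v) u 0 := by
      simpa using (hasDerivAt_id (0 : ℂ)).const_mul u
    have h2 : HasDerivAt k c (u * 0) := by
      rw [mul_zero, ← hk1]; exact hkd 0 (by simp)
    exact (h2.comp 0 h1).mul_const _
  have hR : HasDerivAt (fun v : ℂ => k (u * r) * k (r * v) * k (x * discInvolution r v))
      (k (u * r) * (c * r) * k (x * r) + k (u * r) * k (r * 0) *
        (deriv k (x * r) * (x * ((r : ℂ) ^ 2 - 1)))) 0 := by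
    have h1 : HasDerivAt (fun v : ℂ => (r : ℂ) * v) r 0 := by
      simpa using (hasDerivAt_id (0 : ℂ)).const_mul (r : ℂ)
    have h2 : HasDerivAt k c (r * 0) := by
      rw [mul_zero, ← hk1]; exact hkd 0 (by simp)
    have h3 : HasDerivAt (fun v : ℂ => x * discInvolution r v) (x * ((r : ℂ) ^ 2 - 1)) 0 := by
      have := (hasDerivAt_discInvolution (r := r) (z := 0) (by simp)).const_mul x
      simpa using this
    have h4 : HasDerivAt k (deriv k (x * r)) (x * discInvolution r 0) := by
      rw [discInvolution_zero]
      exact hkd _ (by rw [mul_comm]; exact hs.trans hr1)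
    have h5 := ((h2.comp 0 h1).const_mul (k (u * r))).mul (h4.comp 0 h3)
    simp only [Function.comp_apply, discInvolution_zero] at h5
    exact h5
  have hEq : (fun v : ℂ => k (u * v) * k (r * r)) =ᶠ[nhds 0]
      fun v : ℂ => k (u * r) * k (r * v) * k (x * discInvolution r v) := by
    filter_upwards [ball_mem_nhds (0 : ℂ) one_pos] with v hv
    rw [hcov u v hu1 (mem_ball_zero_iff.mp hv), hux]
  have hder := hL.unique (hR.congr_of_eventuallyEq hEq)
  rw [mul_zero, hk0, hcov0, mul_comm x] at hder
  have hder' : c * u * k (r * x) = c * r * k (r * x) + deriv k (r * x) * (x * ((r : ℂ) ^ 2 - 1)) :=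
    mul_left_cancel₀ hkur (by linear_combination hder)
  have hr2 : ((r : ℂ) ^ 2 - 1) ≠ 0 := by
    rw [sub_ne_zero]
    have : r ^ 2 ≠ 1 := by nlinarith
    exact_mod_cast this
  have huval : u * (1 - r * x) = r - x := by
    rw [hu, discInvolution, div_mul_cancel₀ _ hne]
  -- Since `(u - r)(1 - rx) = x(r² - 1)`, multiplying by `1 - rx` exposes a common factor `x(r² -
  -- 1)`.
  refine mul_left_cancel₀ (mul_ne_zero hx0 hr2) ?_
  linear_combination (-(1 - r * x)) * hder' + c * k (r * x) * huval

end PowerFunction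

/-! ### Schwarz lemma and automorphisms of the Hilbert ball -/

section SchwarzRigidity

variable {E : Type*} [NormedAddCommGroup E] [InnerProductSpace ℂ E]

/-- The equality case of the Schwarz lemma for discs in a Hilbert space. -/
lemma exists_eq_smul_of_norm_eq {h : ℂ → E} (hd : DifferentiableOn ℂ h (ball 0 1))
    (hm : MapsTo h (ball 0 1) (ball 0 1)) (h0 : h 0 = 0) {z : ℂ} (hz0 : z ≠ 0) (hz1 : ‖z‖ < 1)
    (hz : ‖h z‖ = ‖z‖) : ∃ C : E, ‖C‖ = 1 ∧ ∀ w : ℂ, ‖w‖ < 1 → h w = w • C := by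
  -- The real inner product supplies the strict convexity on which the vector-valued equality case
  -- rests.
  let : NormedSpace ℝ E := NormedSpace.restrictScalars ℝ ℂ E
  let : InnerProductSpace ℝ E := InnerProductSpace.rclikeToReal ℂ E
  obtain ⟨C, hC, hEq⟩ := Complex.affine_of_mapsTo_ball_of_exists_norm_dslope_eq_div' hd
    (R₂ := 1) (by rw [h0]; exact hm.mono_right ball_subset_closedBall)
    ⟨z, mem_ball_zero_iff.mpr hz1, by
      rw [dslope_of_ne _ hz0, slope_def_module, h0, sub_zero, sub_zero, norm_smul, hz, norm_inv,
        inv_mul_cancel₀ (norm_ne_zero_iff.mpr hz0), div_one]⟩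
  refine ⟨C, by simpa using hC, fun w hw => ?_⟩
  simpa [h0] using hEq (mem_ball_zero_iff.mpr hw)

variable {F G : E → E}

lemma differentiableOn_comp_smul_discInvolution (hF : DifferentiableOn ℂ F (ball 0 1)) {r : ℝ}
    (hr0 : 0 < r) (hr1 : r < 1) {e : E} (he : ‖e‖ = 1) :
    DifferentiableOn ℂ (fun w : ℂ => F (discInvolution r w • e)) (ball 0 1) := by
  refine hF.comp (fun w hw => ?_) fun w hw => ?_
  · have := (hasDerivAt_discInvolution (one_sub_real_mul_ne_zero hr0 hr1
      (mem_ball_zero_iff.mp hw))).differentiableAt.smul_const e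
    exact this.differentiableWithinAt
  · have := norm_discInvolution_lt_one hr0 hr1 (mem_ball_zero_iff.mp hw)
    simpa [norm_smul, he] using this

lemma mapsTo_comp_smul_discInvolution (hm : MapsTo F (ball 0 1) (ball 0 1)) {r : ℝ}
    (hr0 : 0 < r) (hr1 : r < 1) {e : E} (he : ‖e‖ = 1) :
    MapsTo (fun w : ℂ => F (discInvolution r w • e)) (ball 0 1) (ball 0 1) := fun w hw =>
  hm (by simpa [norm_smul, he] using
    norm_discInvolution_lt_one hr0 hr1 (mem_ball_zero_iff.mp hw))

/-- A holomorphic self-map of the ball with zero `a` satisfies `‖F 0‖ ≤ ‖a‖`. -/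
lemma norm_apply_zero_le_of_apply_eq_zero (hF : DifferentiableOn ℂ F (ball 0 1))
    (hm : MapsTo F (ball 0 1) (ball 0 1)) {a : E} (ha1 : ‖a‖ < 1) (hFa : F a = 0) :
    ‖F 0‖ ≤ ‖a‖ := by
  rcases eq_or_ne a 0 with rfl | ha0
  · simp [hFa]
  have hr0 : 0 < ‖a‖ := norm_pos_iff.mpr ha0
  set e : E := ((‖a‖ : ℂ)⁻¹) • a with hedef
  have he : ‖e‖ = 1 := by simp [hedef, norm_smul, hr0.ne']
  have hea : (‖a‖ : ℂ) • e = a := by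
    rw [hedef, smul_inv_smul₀ (by exact_mod_cast hr0.ne')]
  -- The Schwarz lemma for `w ↦ F(θ(w) e)`, which vanishes at `0`, evaluated at `w = ‖a‖`, where `θ`
  -- vanishes.
  have h := Complex.norm_le_norm_of_mapsTo_ball (z := (‖a‖ : ℂ))
    (differentiableOn_comp_smul_discInvolution hF hr0 ha1 he)
    ((mapsTo_comp_smul_discInvolution hm hr0 ha1 he).mono_right ball_subset_closedBall)
    (by simp [hea, hFa]) (by simpa using ha1)
  simpa using h

/-- An automorphism of the ball with zero `a = r e`, `r ≠ 0`, maps the disc spanned by `e` onto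
a disc through the origin by a Möbius transformation. -/
lemma exists_apply_smul_eq_discInvolution_smul (hF : DifferentiableOn ℂ F (ball 0 1))
    (hFm : MapsTo F (ball 0 1) (ball 0 1)) (hG : DifferentiableOn ℂ G (ball 0 1))
    (hGm : MapsTo G (ball 0 1) (ball 0 1)) (hGF : ∀ z ∈ ball (0 : E) 1, G (F z) = z)
    {r : ℝ} (hr0 : 0 < r) (hr1 : r < 1) {e : E} (he : ‖e‖ = 1) (hFe : F ((r : ℂ) • e) = 0) :
    ∃ C : E, ‖C‖ = 1 ∧ ∀ w : ℂ, ‖w‖ < 1 → F (w • e) = discInvolution r w • C := by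
  have hrn : ‖(r : ℂ)‖ = r := by rw [Complex.norm_real, Real.norm_of_nonneg hr0.le]
  have hre : ‖(r : ℂ) • e‖ = r := by rw [norm_smul, he, hrn, mul_one]
  have h0 : (0 : E) ∈ ball (0 : E) 1 := mem_ball_self one_pos
  have hG0 : G 0 = (r : ℂ) • e := by
    rw [← hFe, hGF _ (by rw [mem_ball_zero_iff, hre]; exact hr1)]
  -- `F` vanishes at `r e` and `G` at `F 0`, so the bound applies both ways and gives `‖F 0‖ = r`:
  -- equality in the Schwarz lemma for `w ↦ F(θ(w) e)` at `w = r`.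
  have hle := norm_apply_zero_le_of_apply_eq_zero hF hFm (hre.trans_lt hr1) hFe
  have hge := norm_apply_zero_le_of_apply_eq_zero hG hGm (mem_ball_zero_iff.mp (hFm h0)) (hGF 0 h0)
  rw [hG0] at hge
  have hnorm : ‖F 0‖ = r := (hle.antisymm hge).trans hre
  obtain ⟨C, hC, hEq⟩ := exists_eq_smul_of_norm_eq (z := (r : ℂ))
    (differentiableOn_comp_smul_discInvolution hF hr0 hr1 he)
    (mapsTo_comp_smul_discInvolution hFm hr0 hr1 he) (by simp only [discInvolution_zero, hFe])
    (by exact_mod_cast hr0.ne') (by rw [hrn]; exact hr1) (by simp [hnorm, abs_of_pos hr0])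
  refine ⟨C, hC, fun w hw => ?_⟩
  rw [← hEq _ (norm_discInvolution_lt_one hr0 hr1 hw), discInvolution_discInvolution hr0 hr1 hw]

/-- **Cartan's theorem** for the ball of a Hilbert space: an automorphism fixing the origin agrees
with its derivative at the origin. -/
lemma apply_eq_fderiv_zero (hF : DifferentiableOn ℂ F (ball 0 1))
    (hFm : MapsTo F (ball 0 1) (ball 0 1)) (hF0 : F 0 = 0)
    (hnorm : ∀ z ∈ ball (0 : E) 1, ‖F z‖ = ‖z‖) {z : E} (hz : ‖z‖ < 1) :
    F z = fderiv ℂ F 0 z := by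
  rcases eq_or_ne z 0 with rfl | hz0
  · simp [hF0]
  have hr0 : 0 < ‖z‖ := norm_pos_iff.mpr hz0
  set e : E := ((‖z‖ : ℂ)⁻¹) • z with hedef
  have he : ‖e‖ = 1 := by simp [hedef, norm_smul, hr0.ne']
  have hez : (‖z‖ : ℂ) • e = z := by
    rw [hedef, smul_inv_smul₀ (by exact_mod_cast hr0.ne')]
  have hball : ∀ w : ℂ, w ∈ ball (0 : ℂ) 1 → w • e ∈ ball (0 : E) 1 := fun w hw => by
    simpa [norm_smul, he] using hw
  obtain ⟨C, -, hEq⟩ := exists_eq_smul_of_norm_eq (h := fun w : ℂ => F (w • e)) (z := (‖z‖ : ℂ))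
    (hF.comp (fun w _ => (differentiableAt_id.smul_const e).differentiableWithinAt) hball)
    (fun w hw => hFm (hball w hw)) (by simp [hF0]) (by exact_mod_cast hr0.ne') (by simpa using hz)
    (by simp [hez, hnorm z (mem_ball_zero_iff.mpr hz)])
  have hFd : HasFDerivAt F (fderiv ℂ F 0) ((0 : ℂ) • e) := by
    rw [zero_smul]
    exact (hF.differentiableAt (ball_mem_nhds _ one_pos)).hasFDerivAt
  -- Computing the derivative of `w ↦ F(w e)` at `0` in two ways identifies `C` with `F'(0) e`.
  have h1 : HasDerivAt (fun w : ℂ => F (w • e)) (fderiv ℂ F 0 e) 0 := by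
    have h := (hasDerivAt_id (0 : ℂ)).smul_const e
    rw [one_smul] at h
    exact hFd.comp_hasDerivAt (0 : ℂ) h
  have h2 : HasDerivAt (fun w : ℂ => F (w • e)) C 0 := by
    have h := (hasDerivAt_id (0 : ℂ)).smul_const C
    rw [one_smul] at h
    refine h.congr_of_eventuallyEq ?_
    filter_upwards [ball_mem_nhds (0 : ℂ) one_pos] with w hw
    exact hEq w (mem_ball_zero_iff.mp hw)
  have hC := h1.unique h2
  calc F z = F ((‖z‖ : ℂ) • e) := by rw [hez]
    _ = (‖z‖ : ℂ) • C := hEq _ (by simpa using hz)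
    _ = fderiv ℂ F 0 z := by rw [← hC, ← map_smul, hez]

/-- An automorphism of the ball fixing the origin is the restriction of a unitary operator. -/
lemma exists_linearIsometryEquiv_of_apply_zero (hF : DifferentiableOn ℂ F (ball 0 1))
    (hFm : MapsTo F (ball 0 1) (ball 0 1)) (hG : DifferentiableOn ℂ G (ball 0 1))
    (hGm : MapsTo G (ball 0 1) (ball 0 1)) (hGF : ∀ z ∈ ball (0 : E) 1, G (F z) = z)
    (hFG : ∀ z ∈ ball (0 : E) 1, F (G z) = z) (hF0 : F 0 = 0) :
    ∃ U : E ≃ₗᵢ[ℂ] E, ∀ z ∈ ball (0 : E) 1, F z = U z := by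
  have hG0 : G 0 = 0 := by simpa [hF0] using hGF 0 (mem_ball_self one_pos)
  have hleF : ∀ z ∈ ball (0 : E) 1, ‖F z‖ ≤ ‖z‖ := fun z hz =>
    Complex.norm_le_norm_of_mapsTo_ball hF (hFm.mono_right ball_subset_closedBall) hF0
      (mem_ball_zero_iff.mp hz)
  have hleG : ∀ z ∈ ball (0 : E) 1, ‖G z‖ ≤ ‖z‖ := fun z hz =>
    Complex.norm_le_norm_of_mapsTo_ball hG (hGm.mono_right ball_subset_closedBall) hG0
      (mem_ball_zero_iff.mp hz)
  have hnF : ∀ z ∈ ball (0 : E) 1, ‖F z‖ = ‖z‖ := fun z hz =>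
    (hleF z hz).antisymm (by simpa [hGF z hz] using hleG _ (hFm hz))
  have hnG : ∀ z ∈ ball (0 : E) 1, ‖G z‖ = ‖z‖ := fun z hz =>
    (hleG z hz).antisymm (by simpa [hFG z hz] using hleF _ (hGm hz))
  have hAF : ∀ z ∈ ball (0 : E) 1, F z = fderiv ℂ F 0 z := fun z hz =>
    apply_eq_fderiv_zero hF hFm hF0 hnF (mem_ball_zero_iff.mp hz)
  have hBG : ∀ z ∈ ball (0 : E) 1, G z = fderiv ℂ G 0 z := fun z hz =>
    apply_eq_fderiv_zero hG hGm hG0 hnG (mem_ball_zero_iff.mp hz)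
  -- Every vector scales into the ball, so identities between linear maps there extend by
  -- homogeneity.
  have hscale : ∀ z : E, ∃ c : ℂ, c ≠ 0 ∧ c • z ∈ ball (0 : E) 1 := fun z => by
    have hp : 0 < ‖z‖ + 1 := by positivity
    refine ⟨((‖z‖ + 1 : ℝ) : ℂ)⁻¹, inv_ne_zero (by exact_mod_cast hp.ne'), ?_⟩
    rw [mem_ball_zero_iff, norm_smul, norm_inv, Complex.norm_real, Real.norm_of_nonneg hp.le,
      inv_mul_lt_iff₀ hp]
    linarith
  have hAnorm : ∀ z : E, ‖fderiv ℂ F 0 z‖ = ‖z‖ := fun z => by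
    obtain ⟨c, hc, hcz⟩ := hscale z
    have h := hnF _ hcz
    rw [hAF _ hcz, map_smul, norm_smul, norm_smul] at h
    exact mul_left_cancel₀ (norm_ne_zero_iff.mpr hc) h
  have hAB : ∀ z : E, fderiv ℂ F 0 (fderiv ℂ G 0 z) = z := fun z => by
    obtain ⟨c, hc, hcz⟩ := hscale z
    have h := hFG _ hcz
    rw [hAF _ (hGm hcz), hBG _ hcz, map_smul, map_smul] at h
    exact smul_right_injective E hc h
  refine ⟨LinearIsometryEquiv.ofSurjective ⟨(fderiv ℂ F 0 : E →ₗ[ℂ] E), hAnorm⟩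
    fun z => ⟨fderiv ℂ G 0 z, hAB z⟩, hAF⟩

end SchwarzRigidity

/-! ### Kernel transformation and the power series of `k` -/

section Kernel

/-- Transformation of the kernel under a co-isometric weighted composition operator. -/
lemma scalarKernel_eq_of_isCoisometricWCO {X H : Type*} [NormedAddCommGroup H]
    [InnerProductSpace ℂ H] [CompleteSpace H] [RKHS ℂ H X ℂ] {δ : X → ℂ} {φ : X → X}
    (hW : IsCoisometricWCO H δ φ) (x y : X) :
    scalarKernel H x y = δ x * conj (δ y) * scalarKernel H (φ x) (φ y) := by
  obtain ⟨T, hT, hTT⟩ := hW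
  have hadj : ContinuousLinearMap.adjoint T (RKHS.kerFun H y 1) =
      conj (δ y) • RKHS.kerFun H (φ y) 1 := by
    refine ext_inner_right ℂ fun f => ?_
    rw [ContinuousLinearMap.adjoint_inner_left, inner_smul_left, RKHS.kerFun_inner,
      RKHS.kerFun_inner, hT]
    simp
  have h := congrArg (fun g : H => g x) (DFunLike.congr_fun hTT (RKHS.kerFun H y 1))
  simp only [ContinuousLinearMap.comp_apply, ContinuousLinearMap.id_apply] at h
  rw [hadj, hT, RKHS.coe_smul, Pi.smul_apply, RKHS.kerFun_apply, RKHS.kerFun_apply,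
    smul_eq_mul] at h
  rw [scalarKernel, scalarKernel, ← h, mul_assoc]

/-- The normalised form of the transformation rule, which does not involve the weight. -/
lemma scalarKernel_mul_eq_of_isCoisometricWCO {X H : Type*} [NormedAddCommGroup H]
    [InnerProductSpace ℂ H] [CompleteSpace H] [RKHS ℂ H X ℂ] {δ : X → ℂ} {φ : X → X}
    (hW : IsCoisometricWCO H δ φ) {a : X} (hl : ∀ x, scalarKernel H x (φ a) = 1)
    (hr : ∀ x, scalarKernel H (φ a) x = 1) (x y : X) :
    scalarKernel H x y * scalarKernel H a a =
      scalarKernel H x a * scalarKernel H a y * scalarKernel H (φ x) (φ y) := by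
  -- Each side carries the same weight `δ x · conj (δ y) · δ a · conj (δ a)`, so no division by `δ`
  -- is needed.
  rw [scalarKernel_eq_of_isCoisometricWCO hW x y, scalarKernel_eq_of_isCoisometricWCO hW a a,
    scalarKernel_eq_of_isCoisometricWCO hW x a, scalarKernel_eq_of_isCoisometricWCO hW a y,
    hl, hl, hr]
  ring

/-- A power series with nonnegative coefficients which converges on `[0, 1)` converges on the
unit disc. -/
lemma hasFPowerSeriesOnBall_tsum_of_summable {a : ℕ → ℝ} (ha : ∀ n, 0 ≤ a n)
    (hs : ∀ ρ : ℝ, 0 ≤ ρ → ρ < 1 → Summable fun n => a n * ρ ^ n) :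
    HasFPowerSeriesOnBall (fun t : ℂ => ∑' n, (a n : ℂ) * t ^ n)
      (FormalMultilinearSeries.ofScalars ℂ fun n => (a n : ℂ)) 0 1 where
  r_le := by
    refine ENNReal.le_of_forall_nnreal_lt fun ρ hρ => ?_
    refine FormalMultilinearSeries.le_radius_of_summable_norm _ ?_
    refine (hs ρ ρ.2 (by exact_mod_cast hρ)).congr fun n => ?_
    rw [FormalMultilinearSeries.ofScalars_norm, Complex.norm_real, Real.norm_of_nonneg (ha n)]
  r_pos := one_pos
  hasSum := by
    intro t ht
    have ht1 : ‖t‖ < 1 := by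
      rw [mem_eball_zero_iff, ← ofReal_norm, ← ENNReal.ofReal_one] at ht
      exact (ENNReal.ofReal_lt_ofReal_iff one_pos).mp ht
    have hsum : Summable fun n => (a n : ℂ) * t ^ n := by
      refine Summable.of_norm ((hs ‖t‖ (norm_nonneg _) ht1).congr fun n => ?_)
      rw [norm_mul, norm_pow, Complex.norm_real, Real.norm_of_nonneg (ha n)]
    simpa [FormalMultilinearSeries.ofScalars_apply_eq, smul_eq_mul, mul_comm] using hsum.hasSum

end Kernel

/-! ### Reduction to one disc and conclusion -/

lemma norm_pairing_lt_one {d : ℕ∞} (z w : UnitBallC d) : ‖pairing z w‖ < 1 := by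
  have hz := mem_ball_zero_iff.mp z.2
  have hw := mem_ball_zero_iff.mp w.2
  refine (norm_inner_le_norm _ _).trans_lt ?_
  nlinarith [norm_nonneg (z : HilbertC d), norm_nonneg (w : HilbertC d)]

lemma pairing_eq_mul_conj {d : ℕ∞} {z w : UnitBallC d} {e : HilbertC d} (he : ‖e‖ = 1) {s t : ℂ}
    (hz : (z : HilbertC d) = s • e) (hw : (w : HilbertC d) = t • e) :
    pairing z w = s * conj t := by
  rw [pairing, hz, hw, inner_smul_left, inner_smul_right, inner_self_eq_norm_sq_to_K, he]
  simp [mul_comm]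

theorem proposition5p2 (d : ℕ∞) {H : Type*} [NormedAddCommGroup H] [InnerProductSpace ℂ H]
    [CompleteSpace H] [RKHS ℂ H (UnitBallC d) ℂ]
    (hH : IsUnitarilyInvariant d H) (hγ : ∀ γ : ℝ, 0 < γ → ¬ IsHGamma d γ H)
    (φ : UnitBallC d → UnitBallC d) (hφ : IsBallAutomorphism φ)
    (δ : UnitBallC d → ℂ) (hW : IsCoisometricWCO H δ φ) :
    IsUnitaryBallMap φ := by
  obtain ⟨⟨F, hF, hFφ⟩, ψ, hψφ, hφψ, G, hG, hGψ⟩ := hφ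
  have hFφ' : ∀ z (hz : z ∈ ball (0 : HilbertC d) 1), F z = φ ⟨z, hz⟩ := fun z hz => hFφ ⟨z, hz⟩
  have hGψ' : ∀ z (hz : z ∈ ball (0 : HilbertC d) 1), G z = ψ ⟨z, hz⟩ := fun z hz => hGψ ⟨z, hz⟩
  have hFm : MapsTo F (ball 0 1) (ball 0 1) := fun z hz => by rw [hFφ' z hz]; exact (φ _).2
  have hGm : MapsTo G (ball 0 1) (ball 0 1) := fun z hz => by rw [hGψ' z hz]; exact (ψ _).2
  have hGF : ∀ z ∈ ball (0 : HilbertC d) 1, G (F z) = z := fun z hz => by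
    rw [hFφ' z hz, hGψ, hψφ]
  have hFG : ∀ z ∈ ball (0 : HilbertC d) 1, F (G z) = z := fun z hz => by
    rw [hGψ' z hz, hFφ, hφψ]
  have h0 : (0 : HilbertC d) ∈ ball (0 : HilbertC d) 1 := mem_ball_self one_pos
  by_cases hF0 : F 0 = 0
  · obtain ⟨U, hU⟩ := exists_linearIsometryEquiv_of_apply_zero hF hFm hG hGm hGF hFG hF0
    exact ⟨U, fun z => by rw [← hFφ, hU _ z.2]⟩
  exfalso
  obtain ⟨a, ha, ha0, ha1, hK⟩ := hH
  set k : ℂ → ℂ := fun t => ∑' n, (a n : ℂ) * t ^ n with hkdef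
  have hKk : ∀ z w : UnitBallC d, scalarKernel H z w = k (pairing z w) := fun z w =>
    (hK z w).tsum_eq.symm
  -- `G 0` is the zero of `F`. It is nonzero here, which also rules out `d = 0` and provides the
  -- unit vector `e`.
  set r : ℝ := ‖G 0‖ with hrdef
  have hG0 : G 0 ≠ 0 := fun h => hF0 (by simpa [h] using hFG 0 h0)
  have hr0 : 0 < r := norm_pos_iff.mpr hG0
  have hr1 : r < 1 := mem_ball_zero_iff.mp (hGm h0)
  set e : HilbertC d := ((r : ℂ)⁻¹) • G 0 with hedef
  have hrC : (r : ℂ) ≠ 0 := by exact_mod_cast hr0.ne'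
  have he : ‖e‖ = 1 := by
    rw [hedef, norm_smul, norm_inv, Complex.norm_real, Real.norm_of_nonneg hr0.le, ← hrdef,
      inv_mul_cancel₀ hr0.ne']
  have hre : (r : ℂ) • e = G 0 := by rw [hedef, smul_inv_smul₀ hrC]
  have hline : ∀ w : ℂ, ‖w‖ < 1 → w • e ∈ ball (0 : HilbertC d) 1 := fun w hw => by
    rwa [mem_ball_zero_iff, norm_smul, he, mul_one]
  obtain ⟨C, hC, hFC⟩ := exists_apply_smul_eq_discInvolution_smul hF hFm hG hGm hGF hr0 hr1 he
    (by rw [hre, hFG 0 h0])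
  have hk_series := hasFPowerSeriesOnBall_tsum_of_summable ha fun ρ hρ0 hρ1 => by
    -- The kernel on the diagonal at `√ρ e` is the series at `ρ`.
    have hρn : ‖((√ρ : ℝ) : ℂ)‖ < 1 := by
      rw [Complex.norm_real, Real.norm_of_nonneg (Real.sqrt_nonneg _), Real.sqrt_lt' one_pos]
      simpa using hρ1
    have h := (hK ⟨_, hline _ hρn⟩ ⟨_, hline _ hρn⟩).summable
    rw [pairing_eq_mul_conj he rfl rfl, Complex.conj_ofReal, ← Complex.ofReal_mul,
      Real.mul_self_sqrt hρ0] at h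
    exact_mod_cast h
  have hk : DifferentiableOn ℂ k (ball 0 1) := by
    have h := hk_series.differentiableOn
    rwa [show Metric.eball (0 : ℂ) 1 = ball 0 1 by
      simpa using Metric.eball_ofReal (x := (0 : ℂ)) (ε := 1)] at h
  have hk0 : k 0 = 1 := by
    rw [hkdef]
    simp only
    rw [tsum_eq_single 0 (fun n hn => by simp [hn])]
    simp [ha0]
  have hk1 : deriv k 0 = (a 1 : ℂ) := by
    rw [hk_series.hasFPowerSeriesAt.deriv]
    simp
  have hrn : ‖(r : ℂ)‖ < 1 := by rwa [Complex.norm_real, Real.norm_of_nonneg hr0.le]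
  have hcov : ∀ u v : ℂ, ‖u‖ < 1 → ‖v‖ < 1 → k (u * v) * k (r * r) =
      k (u * r) * k (r * v) * k (discInvolution r u * discInvolution r v) := by
    intro u v hu hv
    -- The pairing conjugates its second argument, so the point `conj v • e` is used to obtain `u
    -- v`.
    have hv' : ‖conj v‖ < 1 := by rwa [RCLike.norm_conj]
    set p : UnitBallC d := ⟨_, hline _ hrn⟩ with hp
    have hφp : (φ p : HilbertC d) = 0 := by
      rw [← hFφ]
      exact (congrArg F hre).trans (hFG 0 h0)
    have h := scalarKernel_mul_eq_of_isCoisometricWCO hW (a := p)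
      (fun x => by rw [hKk, pairing, hφp, inner_zero_left, hk0])
      (fun x => by rw [hKk, pairing, hφp, inner_zero_right, hk0])
      ⟨_, hline _ hu⟩ ⟨_, hline _ hv'⟩
    simp only [hKk] at h
    rw [pairing_eq_mul_conj he rfl rfl, pairing_eq_mul_conj he rfl rfl,
      pairing_eq_mul_conj he rfl rfl, pairing_eq_mul_conj he rfl rfl,
      pairing_eq_mul_conj hC (by rw [← hFφ]; exact hFC _ hu) (by rw [← hFφ]; exact hFC _ hv'),
      conj_discInvolution, Complex.conj_conj, Complex.conj_ofReal] at h
    exact h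
  have hkr : k (r * r) ≠ 0 := by
    have hrr : ((r : ℂ) * r) ∈ ball (0 : ℂ) 1 := by
      rw [mem_ball_zero_iff, norm_mul]
      nlinarith [norm_nonneg (r : ℂ)]
    have hval : k (r * r) = ((∑' n, a n * (r * r) ^ n : ℝ) : ℂ) := by
      rw [hkdef]; push_cast; rfl
    have hsum : Summable fun n => a n * (r * r) ^ n := by
      have h := (hK ⟨_, hline _ hrn⟩ ⟨_, hline _ hrn⟩).summable
      rw [pairing_eq_mul_conj he rfl rfl, Complex.conj_ofReal] at h
      exact_mod_cast h
    -- The coefficients are nonnegative, so the constant term alone gives `k(r²) ≥ 1`.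
    have hge : a 0 * (r * r) ^ 0 ≤ ∑' n, a n * (r * r) ^ n :=
      hsum.le_tsum 0 fun n _ => mul_nonneg (ha n) (by positivity)
    rw [hval]
    rw [ha0, pow_zero, mul_one] at hge
    exact_mod_cast (one_pos.trans_le hge).ne'
  exact hγ (a 1) ha1 fun z w => by
    rw [hKk, eq_one_div_cpow_of_discInvolution_covariant hr0 hr1 hk hk0 hk1 hkr hcov
      (norm_pairing_lt_one z w)]
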